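/- **Lower bound for pseudo-1d bandit convex optimization (PBCO).** In PBCO with horizon $T$ and action set $\mathcal W\subseteq\mathbb R^d$, in each round $t=1,\dots,T$ a (possibly randomized) learner sees a context $x_t$ and a prediction function $g_t(\cdot\,;\cdot)$, plays a point $w_t\in\mathcal W$ that depends only on the contexts and prediction functions up to round $t$, on the losses it incurred in earlier rounds, and on its internal randomness, which is independent of the losses; it then observes only the number $f_t(w_t)$, where $f_t(w)=\ell_t(g_t(w;x_t))$ and the (random) loss $\ell_t:\mathbb R\to\mathbb R$ is unknown. Its regret is $R_T=\sum_{t=1}^T f_t(w_t)-\min_{w\in\mathcal W}\sum_{t=1}^T f_t(w)$. For all $d$ and $T$ there is a nonempty closed convex set $\mathcal W\subseteq\mathcal B_d(1)=\{w\in\mathbb R^d:\|w\|_2\le 1\}$ such that for every learner $\mathcal A$ playing in $\mathcal W$ there are contexts $x_1,\dots,x_T$ in $\mathcal X=\mathcal B_d(1)$ and random losses $\ell_1,\dots,\ell_T$, chosen before the game, for which, with $g_t(w;x)=\langle w,x\rangle$: * $\ell_t(z)=m_t(z)+\varepsilon_t$ with fixed functions $m_t$ and independent noise variables $\varepsilon_t\sim\mathcal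 N(0,\tfrac1{16})$; * $\mathbb E[f_t(w)]\in[0,1]$ for all $t$ and all $w\in\mathcal W$; * (A1) for all $t$, $w_1,w_2\in\mathcal W$ and $\lambda\in[0,1]$, both $\ell_t(\lambda g_t(w_1;x_t)+(1-\lambda)g_t(w_2;x_t))$ and $f_t(\lambda w_1+(1-\lambda)w_2)$ are at most $\lambda f_t(w_1)+(1-\lambda)f_t(w_2)$; * (A2) $|\ell_t(g_t(w_1;x_t))-\ell_t(g_t(w_2;x_t))|\le|g_t(w_1;x_t)-g_t(w_2;x_t)|$ for all $t$ and all $w_1,w_2\in\mathcal W$; * (A3) $g_t(w;x)\in[-1,1]$ and $\|\nabla_w g_t(w;x)\|_2\le 1$ for all $t$, $w\in\mathcal W$ and $x\in\mathcal X$; and the expected regret (over the noise and the learner's randomness; the minimum is attained and the regret is integrable) satisfies $$\mathbb E[R_T(\mathcal A)]=\mathbb E\Big[\sum_{t=1}^T f_t(w_t)-\min_{w\in\mathcal W}\sum_{t=1}^T f_t(w)\Big]\ \ge\ \frac1{32}\min\big(\sqrt{dT},\,T^{3/4}\big).$$ -/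

import Mathlib

open MeasureTheory ProbabilityTheory
open scoped NNReal

namespace PBCO

/-- The parameter space `ℝ^d` with its Euclidean norm. -/
abbrev E (d : ℕ) : Type := EuclideanSpace ℝ (Fin d)

/-- The adversary's (random) choices over `T` rounds, with contexts in `X`. In round `t` there are a
prediction function `g t`, a context `x t` and a random loss `ℓ t ω : ℝ → ℝ`, where `ω` ranges over
the probability space of the losses. -/
structure Environment (d T : ℕ) (X Ω : Type*) [MeasurableSpace Ω] where
  g : Fin T → E d → X → ℝ
  x : Fin T → X
  ℓ : Fin T → Ω → ℝ → ℝ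
  measurable_ℓ : ∀ t, Measurable fun p : Ω × ℝ => ℓ t p.1 p.2

/-- The loss of round `t` as a function of the parameter: `f_t(w) = ℓ_t(g_t(w; x_t))`. -/
def Environment.loss {d T : ℕ} {X Ω : Type*} [MeasurableSpace Ω] (env : Environment d T X Ω)
    (t : Fin T) (ω : Ω) (w : E d) : ℝ :=
  env.ℓ t ω (env.g t w (env.x t))

/-- A (possibly randomized) learner for the action set `W` and the horizon `T`, whose internal
randomness is a seed in `S`. In round `t` it knows the prediction functions and the contexts of the
rounds up to and including `t`, its seed, and the losses it has incurred in the earlier rounds;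
it chooses a point of `W`. (Its own earlier choices are functions of these data.) -/
structure Algorithm (d T : ℕ) (W : Set (E d)) (X S : Type*) [MeasurableSpace S] where
  act : (t : Fin T) → (Fin (t.val + 1) → (E d → X → ℝ) × X) → S → (Fin t.val → ℝ) → W
  measurable_act : ∀ (t : Fin T) (info : Fin (t.val + 1) → (E d → X → ℝ) × X),
    Measurable fun p : S × (Fin t.val → ℝ) => act t info p.1 p.2

/-- The point `w_t` that the learner plays in round `t` against the environment: the feedback it has
received consists of the values `f_i(w_i)`, `i < t`. -/
def Algorithm.play {d T : ℕ} {W : Set (E d)} {X S Ω : Type*} [MeasurableSpace S]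
    [MeasurableSpace Ω] (A : Algorithm d T W X S) (env : Environment d T X Ω) (ω : Ω) (s : S)
    (t : Fin T) : W :=
  A.act t
    (fun i => (env.g ⟨i.val, by have := i.isLt; have := t.isLt; omega⟩,
      env.x ⟨i.val, by have := i.isLt; have := t.isLt; omega⟩))
    s
    (fun i => env.loss ⟨i.val, i.isLt.trans t.isLt⟩ ω
      (Algorithm.play A env ω s ⟨i.val, i.isLt.trans t.isLt⟩ : W))
  termination_by t.val
  decreasing_by exact i.isLt

/-- The regret `∑ f_t(w_t) - min_{w ∈ W} ∑ f_t(w)` on the outcome `ω` of the losses and the outcome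
`s` of the learner's seed. -/
noncomputable def Algorithm.regret {d T : ℕ} {W : Set (E d)} {X S Ω : Type*} [MeasurableSpace S]
    [MeasurableSpace Ω] (A : Algorithm d T W X S) (env : Environment d T X Ω) (ω : Ω) (s : S) : ℝ :=
  ∑ t, env.loss t ω (A.play env ω s t) - ⨅ w : W, ∑ t, env.loss t ω w

/-- Convexity of the loss `ℓ` along the values of `g` on `W`, and convexity of `ℓ ∘ g` on `W`. -/
def ConvexityAssumption {d : ℕ} (W : Set (E d)) (ℓ : ℝ → ℝ) (g : E d → ℝ) : Prop :=
  ∀ w₁ ∈ W, ∀ w₂ ∈ W, ∀ c ∈ Set.Icc (0 : ℝ) 1,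
    ℓ (c * g w₁ + (1 - c) * g w₂) ≤ c * ℓ (g w₁) + (1 - c) * ℓ (g w₂) ∧
    ℓ (g (c • w₁ + (1 - c) • w₂)) ≤ c * ℓ (g w₁) + (1 - c) * ℓ (g w₂)

/-- `L`-Lipschitzness of the loss `ℓ` along the values of `g` on `W`. -/
def LipschitzAssumption {d : ℕ} (L : ℝ) (W : Set (E d)) (ℓ : ℝ → ℝ) (g : E d → ℝ) : Prop :=
  ∀ w₁ ∈ W, ∀ w₂ ∈ W, |ℓ (g w₁) - ℓ (g w₂)| ≤ L * |g w₁ - g w₂|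

/-- For all contexts, `g` takes values in `[α, β]` on `W` and its gradient there is at most `D`. -/
def BoundednessAssumption {d : ℕ} {X : Type*} (α β D : ℝ) (W : Set (E d)) (g : E d → X → ℝ) :
    Prop :=
  ∀ x, ∀ w ∈ W, g w x ∈ Set.Icc α β ∧ DifferentiableAt ℝ (fun v => g v x) w ∧
    ‖gradient (fun v => g v x) w‖ ≤ D

end PBCO

/-!
The losses are affine: in round `t` the context is a coordinate vector `e_i`, the loss is
`1/2 + μ σ_i z + ε_t`, and the signs `σ_i` are hidden from the learner. The rounds are distributed
evenly over `n = min d ⌈√T⌉` coordinates and the action set is the cube of half-side `r = 1/√n` in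
these coordinates, which lies in the unit ball. The noise cancels in the regret, and the best
point of the cube is the corner `-r σ`, whose loss is `μ r` below `1/2` in every round; so the
regret is `T μ r + ∑ μ σ_{i(t)} ⟨w_t, x_t⟩`, and it suffices that for some `σ` the expectation of
the sum is at least `-T μ r / 2`.

This holds on average over `σ`, since a learner that has seen at most `2T/n` noisy values of the
slope `μ σ_i` cannot tell its sign. To make this precise, the game is compared with the game in
which the slopes of block `i` are replaced by `0`, so that the sign `σ_i` does not matter at all.
The comparison uses the inequality `(∫ F dQ)² ≤ C ∫ F² dP` for all `F ≥ 0` (`ChiSqDom Q P C`). It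
is a form of `∫ (dQ/dP)² dP ≤ C` that passes to images and is multiplicative under the addition of
a Gaussian observation whose mean depends on the past (`ChiSqDom.add_gaussian`), so that it can be
carried through the game round by round (`Algorithm.historyLaw_chiSqDom`). For probability
measures it bounds the difference of expectations of a function with values in `[-r, r]` by
`r √(C - 1)` (`ChiSqDom.sq_integral_sub_le`). For `μ = n / (16 √T)` the constant is at most
`exp (1/8) ≤ 5/4`, the difference at most `r / 2`, and the expected regret at least
`T μ r / 2 = √(n T) / 32 ≥ min (√(d T)) (T ^ (3/4)) / 32`.
-/

namespace PBCO

open scoped ENNReal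

/-! ### Chi-square domination of measures -/

/-- `Q` is dominated by `P` with chi-square constant `C`: `(∫ F dQ)² ≤ C ∫ F² dP` for all measurable
`F ≥ 0`. For probability measures and finite `C` this says, by duality, that `Q` has a density `D`
with respect to `P` and `∫ D² dP ≤ C`; the dual form needs no densities. -/
def ChiSqDom {α : Type*} [MeasurableSpace α] (Q P : Measure α) (C : ℝ≥0∞) : Prop :=
  ∀ F : α → ℝ≥0∞, Measurable F → (∫⁻ y, F y ∂Q) ^ 2 ≤ C * ∫⁻ y, F y ^ 2 ∂P

namespace ChiSqDom

variable {α β : Type*} [MeasurableSpace α] [MeasurableSpace β]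

theorem mono {Q P : Measure α} {C C' : ℝ≥0∞} (h : ChiSqDom Q P C) (hC : C ≤ C') :
    ChiSqDom Q P C' :=
  fun F hF => (h F hF).trans (by gcongr)

theorem withDensity {P : Measure α} {D : α → ℝ≥0∞} (hD : Measurable D) :
    ChiSqDom (P.withDensity D) P (∫⁻ y, D y ^ 2 ∂P) := by
  intro F hF
  rw [lintegral_withDensity_eq_lintegral_mul _ hD hF]
  have h := ENNReal.lintegral_mul_le_Lp_mul_Lq P Real.HolderConjugate.two_two
    hD.aemeasurable hF.aemeasurable
  calc (∫⁻ y, (D * F) y ∂P) ^ 2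
      ≤ ((∫⁻ y, D y ^ (2 : ℝ) ∂P) ^ (1 / (2 : ℝ)) *
          (∫⁻ y, F y ^ (2 : ℝ) ∂P) ^ (1 / (2 : ℝ))) ^ 2 := by
        gcongr
    _ = _ := by
        rw [mul_pow]
        simp only [← ENNReal.rpow_natCast, ← ENNReal.rpow_mul]
        norm_num

theorem refl (P : Measure α) [IsProbabilityMeasure P] : ChiSqDom P P 1 := by
  simpa using withDensity (P := P) (D := 1) measurable_one

theorem map {Q P : Measure α} {C : ℝ≥0∞} (h : ChiSqDom Q P C) {f : α → β} (hf : Measurable f) :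
    ChiSqDom (Q.map f) (P.map f) C := by
  intro F hF
  rw [lintegral_map hF hf, lintegral_map (hF.pow_const 2) hf]
  exact h _ (hF.comp hf)

/-- The constant is `∫ D² dN(a, v)` for the density `D` of `N(b, v)` with respect to `N(a, v)`: up
to this factor, `D²` is the density of `N(2b - a, v)` with respect to `N(a, v)`. -/
theorem gaussianReal (a b : ℝ) {v : ℝ≥0} (hv : v ≠ 0) :
    ChiSqDom (gaussianReal b v) (gaussianReal a v)
      (ENNReal.ofReal (Real.exp ((b - a) ^ 2 / v))) := by
  have hv' : (v : ℝ) ≠ 0 := by exact_mod_cast hv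
  let D : ℝ → ℝ≥0∞ := fun y => ENNReal.ofReal (Real.exp ((b - a) * (2 * y - a - b) / (2 * v)))
  have hD : Measurable D := by fun_prop
  have hQ : ProbabilityTheory.gaussianReal b v
      = (ProbabilityTheory.gaussianReal a v).withDensity D := by
    rw [gaussianReal_of_var_ne_zero _ hv, gaussianReal_of_var_ne_zero _ hv,
      ← withDensity_mul _ (measurable_gaussianPDF _ _) hD]
    congr 1
    ext y
    simp only [Pi.mul_apply, gaussianPDF, D]
    rw [← ENNReal.ofReal_mul (gaussianPDFReal_nonneg _ _ _)]
    congr 1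
    simp only [gaussianPDFReal]
    rw [mul_assoc _ (Real.exp _), ← Real.exp_add]
    congr 2
    field_simp
    ring
  have hD2 : ∫⁻ y, D y ^ 2 ∂(ProbabilityTheory.gaussianReal a v)
      = ENNReal.ofReal (Real.exp ((b - a) ^ 2 / v)) := by
    rw [gaussianReal_of_var_ne_zero _ hv,
      lintegral_withDensity_eq_lintegral_mul _ (measurable_gaussianPDF _ _) (hD.pow_const 2)]
    have : ∀ y, (gaussianPDF a v * fun y => D y ^ 2) y
        = ENNReal.ofReal (Real.exp ((b - a) ^ 2 / v)) * gaussianPDF (2 * b - a) v y := by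
      intro y
      simp only [Pi.mul_apply, gaussianPDF, D]
      rw [← ENNReal.ofReal_pow (by positivity), ← ENNReal.ofReal_mul (gaussianPDFReal_nonneg _ _ _),
        ← ENNReal.ofReal_mul (by positivity)]
      congr 1
      simp only [gaussianPDFReal]
      rw [mul_assoc, mul_left_comm (Real.exp _), ← Real.exp_nat_mul, ← Real.exp_add, ← Real.exp_add]
      congr 2
      push_cast
      field_simp
      ring
    rw [lintegral_congr this, lintegral_const_mul _ (measurable_gaussianPDF _ _),
      lintegral_gaussianPDF_eq_one _ hv, mul_one]
  rw [← hD2, hQ]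
  exact withDensity hD

/-- Chi-square domination is multiplicative under one more observation, the sum of a Gaussian
variable and a mean that depends on the earlier data. -/
theorem add_gaussian {Q P : Measure α} [SFinite Q] [SFinite P] {C : ℝ≥0∞} (h : ChiSqDom Q P C)
    {v : ℝ≥0} (hv : v ≠ 0) {a b : α → ℝ} (ha : Measurable a) (hb : Measurable b) {δ : ℝ}
    (hδ : ∀ y, (b y - a y) ^ 2 ≤ δ) :
    ChiSqDom
      ((Q.prod (ProbabilityTheory.gaussianReal 0 v)).map fun p => (p.1, b p.1 + p.2))
      ((P.prod (ProbabilityTheory.gaussianReal 0 v)).map fun p => (p.1, a p.1 + p.2))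
      (C * ENNReal.ofReal (Real.exp (δ / v))) := by
  intro F hF
  have slice : ∀ (c : ℝ) (G : ℝ → ℝ≥0∞) (_ : Measurable G),
      (∫⁻ z, G z ∂(ProbabilityTheory.gaussianReal c v))
        = ∫⁻ z, G (c + z) ∂(ProbabilityTheory.gaussianReal 0 v) := by
    intro c G hG
    rw [← lintegral_map (g := fun z => c + z) hG (by fun_prop), gaussianReal_map_const_add,
      zero_add]
  have key : ∀ (μ : Measure α) [SFinite μ] (c : α → ℝ) (_ : Measurable c) (G : α × ℝ → ℝ≥0∞)
      (_ : Measurable G),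
      (∫⁻ p, G p ∂((μ.prod (ProbabilityTheory.gaussianReal 0 v)).map fun p => (p.1, c p.1 + p.2)))
        = ∫⁻ y, (∫⁻ z, G (y, z) ∂(ProbabilityTheory.gaussianReal (c y) v)) ∂μ := by
    intro μ _ c hc G hG
    rw [lintegral_map hG (by fun_prop), lintegral_prod _ (by fun_prop)]
    exact lintegral_congr fun y => (slice (c y) (fun z => G (y, z)) (by fun_prop)).symm
  have meas : ∀ (c : α → ℝ) (_ : Measurable c) (G : α × ℝ → ℝ≥0∞) (_ : Measurable G),
      Measurable fun y => ∫⁻ z, G (y, z) ∂(ProbabilityTheory.gaussianReal (c y) v) := by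
    intro c hc G hG
    have hs : ∀ y, (∫⁻ z, G (y, z) ∂(ProbabilityTheory.gaussianReal (c y) v))
        = ∫⁻ z, G (y, c y + z) ∂(ProbabilityTheory.gaussianReal 0 v) :=
      fun y => slice (c y) (fun z => G (y, z)) (by fun_prop)
    simp_rw [hs]
    exact Measurable.lintegral_prod_right' (f := fun p : α × ℝ => G (p.1, c p.1 + p.2))
      (by fun_prop)
  rw [key Q b hb F hF, key P a ha _ (hF.pow_const 2), mul_assoc]
  refine (h _ (meas b hb F hF)).trans ?_
  rw [← lintegral_const_mul _ (meas a ha _ (hF.pow_const 2))]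
  gcongr with y
  refine (((gaussianReal (a y) (b y) hv).mono ?_) _ (by fun_prop))
  gcongr
  exact hδ y

theorem sq_integral_le {Q P : Measure α} [IsFiniteMeasure P] {C : ℝ} (hC : 0 ≤ C)
    (h : ChiSqDom Q P (ENNReal.ofReal C)) {f : α → ℝ} (hf : Measurable f) {r : ℝ}
    (hr : ∀ y, |f y| ≤ r) :
    (∫ y, f y ∂Q) ^ 2 ≤ C * ∫ y, f y ^ 2 ∂P := by
  have hint : Integrable (fun y => f y ^ 2) P :=
    Integrable.of_bound (by fun_prop) (r ^ 2) (.of_forall fun y => by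
      rw [Real.norm_of_nonneg (sq_nonneg _)]
      exact sq_le_sq' (abs_le.1 (hr y)).1 (abs_le.1 (hr y)).2)
  have h0 : 0 ≤ ∫ y, f y ^ 2 ∂P := integral_nonneg fun y => sq_nonneg _
  rw [← ENNReal.ofReal_le_ofReal_iff (mul_nonneg hC h0), ENNReal.ofReal_mul hC,
    ofReal_integral_eq_lintegral_ofReal hint (.of_forall fun y => sq_nonneg _)]
  calc ENNReal.ofReal ((∫ y, f y ∂Q) ^ 2) = ‖∫ y, f y ∂Q‖ₑ ^ 2 := by
        rw [← sq_abs, ENNReal.ofReal_pow (abs_nonneg _), Real.enorm_eq_ofReal_abs]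
    _ ≤ (∫⁻ y, ‖f y‖ₑ ∂Q) ^ 2 := by gcongr; exact enorm_integral_le_lintegral_enorm _
    _ ≤ ENNReal.ofReal C * ∫⁻ y, ‖f y‖ₑ ^ 2 ∂P := h _ (by fun_prop)
    _ = _ := by
        congr 1
        refine lintegral_congr fun y => ?_
        rw [← sq_abs (f y), ENNReal.ofReal_pow (abs_nonneg _), Real.enorm_eq_ofReal_abs]

/-- The inequality of `ChiSqDom.sq_integral_le`, applied to `f` shifted by constants, turns the
factor `C` into `C - 1`. -/
theorem sq_integral_sub_le {Q P : Measure α} [IsProbabilityMeasure Q] [IsProbabilityMeasure P]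
    {C : ℝ} (hC : 1 < C) (h : ChiSqDom Q P (ENNReal.ofReal C)) {f : α → ℝ} (hf : Measurable f)
    {r : ℝ} (hr : ∀ y, |f y| ≤ r) :
    (∫ y, f y ∂Q - ∫ y, f y ∂P) ^ 2 ≤ (C - 1) * r ^ 2 := by
  have hint : ∀ (R : Measure α) [IsProbabilityMeasure R], Integrable f R := fun R _ =>
    Integrable.of_bound hf.aestronglyMeasurable r (.of_forall hr)
  have hsq : ∀ y, f y ^ 2 ≤ r ^ 2 := fun y => sq_le_sq' (abs_le.1 (hr y)).1 (abs_le.1 (hr y)).2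
  have hint2 : Integrable (fun y => f y ^ 2) P :=
    Integrable.of_bound (by fun_prop) (r ^ 2) (.of_forall fun y => by
      rw [Real.norm_of_nonneg (sq_nonneg _)]; exact hsq y)
  have hle : ∫ y, f y ^ 2 ∂P ≤ r ^ 2 := by
    simpa using integral_mono hint2 (integrable_const (r ^ 2)) hsq
  set e := ∫ y, f y ∂P
  set x := ∫ y, f y ∂Q - e with hx
  have key : ∀ t : ℝ, (x + t) ^ 2 ≤ C * (r ^ 2 + t ^ 2) := by
    intro t
    have h1 := h.sq_integral_le (by linarith) (f := fun y => f y + (t - e)) (by fun_prop)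
      (r := r + |t - e|) (fun y => (abs_add_le _ _).trans (by gcongr; exact hr y))
    rw [integral_add (hint Q) (integrable_const _)] at h1
    have h2 : ∫ y, (f y + (t - e)) ^ 2 ∂P = ∫ y, f y ^ 2 ∂P + 2 * (t - e) * e + (t - e) ^ 2 := by
      have : ∀ y, (f y + (t - e)) ^ 2 = f y ^ 2 + 2 * (t - e) * f y + (t - e) ^ 2 :=
        fun y => by ring
      simp_rw [this]
      rw [integral_add (f := fun y => f y ^ 2 + 2 * (t - e) * f y)
          (hint2.add ((hint P).const_mul _)) (integrable_const _),
        integral_add hint2 ((hint P).const_mul _), integral_const_mul]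
      simp [e]
    rw [h2] at h1
    simp only [integral_const, probReal_univ, smul_eq_mul, one_mul] at h1
    calc (x + t) ^ 2 = (∫ y, f y ∂Q + (t - e)) ^ 2 := by rw [hx]; ring
      _ ≤ _ := h1
      _ ≤ _ := mul_le_mul_of_nonneg_left (by nlinarith [sq_nonneg e]) (by linarith)
  -- the value of `t` for which the bound on `x` is best
  have h3 := key (x / (C - 1))
  have hC1 : 0 < C - 1 := by linarith
  have e1 : x + x / (C - 1) = x * C / (C - 1) := by field_simp; ring
  rw [e1, div_pow, div_pow, div_le_iff₀ (by positivity)] at h3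
  have e2 : C * (r ^ 2 + x ^ 2 / (C - 1) ^ 2) * (C - 1) ^ 2
      = C * (r ^ 2 * (C - 1) ^ 2 + x ^ 2) := by field_simp
  rw [e2] at h3
  have h4 : (C * (C - 1)) * x ^ 2 ≤ (C * (C - 1)) * ((C - 1) * r ^ 2) := by nlinarith
  exact le_of_mul_le_mul_left h4 (by positivity)

end ChiSqDom

/-! ### Affine losses with Gaussian noise and the history of the game -/

/-- The law of the noise: independent centred Gaussian variables of variance `1/16`, one per
round. -/
noncomputable def noise (T : ℕ) : Measure (Fin T → ℝ) :=
  Measure.pi fun _ => gaussianReal 0 (1 / 16 : ℝ≥0)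

instance (T : ℕ) : IsProbabilityMeasure (noise T) := by
  unfold noise; infer_instance

variable {d T : ℕ} {W : Set (E d)} {S : Type*} [MeasurableSpace S]

/-- The environment with linear predictions, contexts `x` and losses `ℓ_t(z) = 1/2 + a_t z + ε_t`,
where the noise `ε_t` is the `t`-th coordinate of the outcome. -/
noncomputable def affineEnv (x : Fin T → Metric.closedBall (0 : E d) 1) (a : Fin T → ℝ) :
    Environment d T (Metric.closedBall (0 : E d) 1) (Fin T → ℝ) where
  g _ w x := inner ℝ w (x : E d)
  x := x
  ℓ t ω z := 1 / 2 + a t * z + ω t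
  measurable_ℓ t := by fun_prop

theorem affineEnv_loss (x : Fin T → Metric.closedBall (0 : E d) 1) (a : Fin T → ℝ) (t : Fin T)
    (ω : Fin T → ℝ) (w : E d) :
    (affineEnv x a).loss t ω w = 1 / 2 + a t * inner ℝ w (x t : E d) + ω t := rfl

theorem measurable_snoc {k : ℕ} :
    Measurable fun p : (Fin k → ℝ) × ℝ => Fin.snoc (α := fun _ => ℝ) p.1 p.2 := by
  refine measurable_pi_lambda _ fun i => ?_
  refine Fin.lastCases ?_ (fun j => ?_) i
  · simp only [Fin.snoc_last]
    fun_prop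
  · simp only [Fin.snoc_castSucc]
    fun_prop

namespace Algorithm

variable (A : Algorithm d T W (Metric.closedBall (0 : E d) 1) S)
  (x : Fin T → Metric.closedBall (0 : E d) 1) (a : Fin T → ℝ)

/-- The predicted value `⟨w_t, x_t⟩` of round `t`, as a function of the seed and of the losses `y`
incurred before. It does not involve the slopes of the losses. -/
noncomputable def prediction (s : S) (t : Fin T) (y : Fin t → ℝ) : ℝ :=
  inner ℝ (A.act t (fun i => (fun w u => inner ℝ w (u : E d), x ⟨i, by omega⟩)) s y : E d)
    (x t : E d)

/-- The losses that the learner incurs in the first `k` rounds. -/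
noncomputable def history (ω : Fin T → ℝ) (s : S) (k : ℕ) (hk : k ≤ T) : Fin k → ℝ :=
  fun i => (affineEnv x a).loss (i.castLE hk) ω (A.play (affineEnv x a) ω s (i.castLE hk))

theorem play_eq (ω : Fin T → ℝ) (s : S) (t : Fin T) :
    A.play (affineEnv x a) ω s t
      = A.act t (fun i => (fun w u => inner ℝ w (u : E d), x ⟨i, by omega⟩)) s
          (A.history x a ω s t t.isLt.le) := by
  rw [play]
  rfl

theorem inner_play (ω : Fin T → ℝ) (s : S) (t : Fin T) :
    inner ℝ (A.play (affineEnv x a) ω s t : E d) (x t : E d)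
      = A.prediction x s t (A.history x a ω s t t.isLt.le) := by
  rw [play_eq]
  rfl

theorem history_succ (ω : Fin T → ℝ) (s : S) (k : ℕ) (hk : k + 1 ≤ T) :
    A.history x a ω s (k + 1) hk
      = Fin.snoc (α := fun _ => ℝ) (A.history x a ω s k (by omega))
          (1 / 2 + a ⟨k, hk⟩ * A.prediction x s ⟨k, hk⟩ (A.history x a ω s k (by omega))
            + ω ⟨k, hk⟩) := by
  ext i
  refine Fin.lastCases ?_ (fun j => ?_) i
  · rw [Fin.snoc_last]
    change (affineEnv x a).loss ⟨k, hk⟩ ω (A.play (affineEnv x a) ω s ⟨k, hk⟩) = _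
    rw [affineEnv_loss, inner_play]
  · rw [Fin.snoc_castSucc]
    rfl

theorem measurable_prediction (t : Fin T) :
    Measurable fun p : S × (Fin t → ℝ) => A.prediction x p.1 t p.2 := by
  have h := measurable_subtype_coe.comp (A.measurable_act t
    (fun i => (fun w u => inner ℝ w (u : E d), x ⟨i, by omega⟩)))
  exact h.inner measurable_const

theorem measurable_history (k : ℕ) (hk : k ≤ T) :
    Measurable fun p : (Fin T → ℝ) × S => A.history x a p.1 p.2 k hk := by
  induction k with
  | zero => exact measurable_pi_lambda _ fun i => i.elim0
  | succ k ih =>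
    have ih := ih (by omega)
    simp_rw [history_succ]
    have h1 : Measurable fun p : (Fin T → ℝ) × S =>
        A.prediction x p.2 ⟨k, hk⟩ (A.history x a p.1 p.2 k (by omega)) :=
      (A.measurable_prediction x ⟨k, hk⟩).comp (measurable_snd.prodMk ih)
    refine measurable_pi_lambda _ fun i => ?_
    refine Fin.lastCases ?_ (fun j => ?_) i
    · simp only [Fin.snoc_last]
      fun_prop
    · simp only [Fin.snoc_castSucc]
      exact (measurable_pi_apply j).comp ih

theorem measurable_inner_play (t : Fin T) :
    Measurable fun p : (Fin T → ℝ) × S =>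
      inner ℝ (A.play (affineEnv x a) p.1 p.2 t : E d) (x t : E d) := by
  simp_rw [inner_play]
  exact (A.measurable_prediction x t).comp
    (measurable_snd.prodMk (A.measurable_history x a t t.isLt.le))

/-- The first `k` losses depend only on the noise of the first `k` rounds. -/
theorem history_congr {ω ω' : Fin T → ℝ} (s : S) (k : ℕ) (hk : k ≤ T)
    (h : ∀ j : Fin T, j.val < k → ω j = ω' j) :
    A.history x a ω s k hk = A.history x a ω' s k hk := by
  induction k with
  | zero => exact funext fun i => i.elim0
  | succ k ih =>
    rw [history_succ, history_succ, ih (by omega) fun j hj => h j (by omega),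
      h ⟨k, hk⟩ (Nat.lt_succ_self k)]

theorem measurable_history_left (s : S) (k : ℕ) (hk : k ≤ T) :
    Measurable fun ω => A.history x a ω s k hk := by
  have h := (A.measurable_history x a k hk).comp (measurable_prodMk_right (y := s))
  exact h

theorem indepFun_history (s : S) (k : ℕ) (hk : k + 1 ≤ T) :
    IndepFun (fun ω => A.history x a ω s k (by omega)) (fun ω => ω ⟨k, hk⟩) (noise T) := by
  have hind : iIndepFun (fun (j : Fin T) (ω : Fin T → ℝ) => ω j) (noise T) :=
    iIndepFun_pi (X := fun _ y => y) fun _ => aemeasurable_id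
  have h := hind.indepFun_finset (Finset.Iio ⟨k, hk⟩) {⟨k, hk⟩}
    (by simp) fun j => measurable_pi_apply j
  -- the history is a function of the noise of the earlier rounds, extended by `0`
  let ext : (Finset.Iio (⟨k, hk⟩ : Fin T) → ℝ) → Fin T → ℝ :=
    fun u j => if hj : j ∈ Finset.Iio (⟨k, hk⟩ : Fin T) then u ⟨j, hj⟩ else 0
  have hext : Measurable ext := by
    refine measurable_pi_lambda _ fun j => ?_
    by_cases hj : j ∈ Finset.Iio (⟨k, hk⟩ : Fin T)
    · simp only [ext, hj, dite_true]
      fun_prop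
    · simp only [ext, hj, dite_false]
      fun_prop
  have hm := (A.measurable_history_left x a s k (by omega)).comp hext
  have hlast := measurable_pi_apply (X := fun _ => ℝ)
    (⟨⟨k, hk⟩, Finset.mem_singleton_self _⟩ : ({⟨k, hk⟩} : Finset (Fin T)))
  have hcomp := h.comp hm hlast
  have heq : (fun ω => A.history x a ω s k (by omega))
      = (fun u => A.history x a (ext u) s k (by omega)) ∘ fun ω i => ω i := by
    funext ω
    refine A.history_congr x a s k _ fun j hj => ?_
    have hj' : j ∈ Finset.Iio (⟨k, hk⟩ : Fin T) := Finset.mem_Iio.2 hj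
    simp only [ext, hj', dite_true]
  rw [heq]
  exact hcomp

/-- The law of the losses of the first `k` rounds for a fixed seed. -/
noncomputable def historyLaw (s : S) (k : ℕ) (hk : k ≤ T) : Measure (Fin k → ℝ) :=
  (noise T).map fun ω => A.history x a ω s k hk

instance (s : S) (k : ℕ) (hk : k ≤ T) : IsProbabilityMeasure (A.historyLaw x a s k hk) :=
  Measure.isProbabilityMeasure_map (A.measurable_history_left x a s k hk).aemeasurable

theorem historyLaw_succ (s : S) (k : ℕ) (hk : k + 1 ≤ T) :
    A.historyLaw x a s (k + 1) hk
      = (((A.historyLaw x a s k (by omega)).prod (gaussianReal 0 (1 / 16 : ℝ≥0))).map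
          fun p => (p.1, 1 / 2 + a ⟨k, hk⟩ * A.prediction x s ⟨k, hk⟩ p.1 + p.2)).map
        fun p => Fin.snoc (α := fun _ => ℝ) p.1 p.2 := by
  have hlaw : (noise T).map (fun ω => ω ⟨k, hk⟩) = gaussianReal 0 (1 / 16 : ℝ≥0) :=
    (measurePreserving_eval (fun _ : Fin T => gaussianReal 0 (1 / 16 : ℝ≥0)) ⟨k, hk⟩).map_eq
  have hprod := (indepFun_iff_map_prod_eq_prod_map_map
    (A.measurable_history_left x a s k (by omega)).aemeasurable
    (measurable_pi_apply _).aemeasurable).1 (A.indepFun_history x a s k hk)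
  have hp : Measurable fun y => A.prediction x s ⟨k, hk⟩ y :=
    (A.measurable_prediction x ⟨k, hk⟩).comp (measurable_const.prodMk measurable_id)
  have hsnoc := measurable_snoc (k := k)
  have hh := A.measurable_history_left x a s k (by omega)
  rw [← hlaw, historyLaw, historyLaw, ← hprod, Measure.map_map (by fun_prop) (by fun_prop),
    Measure.map_map (by fun_prop) (by fun_prop)]
  congr 1
  funext ω
  exact A.history_succ x a ω s k hk

end Algorithm

/-! ### Comparison of two slope vectors -/

namespace Algorithm

variable (A : Algorithm d T W (Metric.closedBall (0 : E d) 1) S)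
  (x : Fin T → Metric.closedBall (0 : E d) 1) (a a' : Fin T → ℝ)

theorem measurable_prediction_right (s : S) (t : Fin T) :
    Measurable fun y => A.prediction x s t y := by
  have h := (A.measurable_prediction x t).comp (measurable_prodMk_left (x := s))
  exact h

theorem abs_prediction_le {r : ℝ} (hr : ∀ t, ∀ w ∈ W, |inner ℝ w (x t : E d)| ≤ r) (s : S)
    (t : Fin T) (y : Fin t → ℝ) : |A.prediction x s t y| ≤ r :=
  hr t _ (Subtype.coe_prop _)

/-- Two slope vectors lead to similar histories: round `j` contributes to the exponent the squared
difference `r² (a_j - a'_j)²` of the means of the observation, divided by the variance `1/16`. -/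
theorem historyLaw_chiSqDom {r : ℝ} (hr : ∀ t, ∀ w ∈ W, |inner ℝ w (x t : E d)| ≤ r) (s : S)
    (k : ℕ) (hk : k ≤ T) :
    ChiSqDom (A.historyLaw x a s k hk) (A.historyLaw x a' s k hk)
      (ENNReal.ofReal (Real.exp
        (∑ j : Fin k, 16 * r ^ 2 * (a (j.castLE hk) - a' (j.castLE hk)) ^ 2))) := by
  induction k with
  | zero =>
    have : A.historyLaw x a s 0 hk = A.historyLaw x a' s 0 hk := by
      unfold historyLaw
      congr 1
      funext ω
      exact Subsingleton.elim _ _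
    rw [this]
    simpa using ChiSqDom.refl (A.historyLaw x a' s 0 hk)
  | succ k ih =>
    rw [historyLaw_succ, historyLaw_succ]
    have hp := A.measurable_prediction_right x s ⟨k, hk⟩
    have hstep := ChiSqDom.add_gaussian (ih (by omega)) (v := 1 / 16) (by norm_num)
      (a := fun y => 1 / 2 + a' ⟨k, hk⟩ * A.prediction x s ⟨k, hk⟩ y)
      (b := fun y => 1 / 2 + a ⟨k, hk⟩ * A.prediction x s ⟨k, hk⟩ y)
      (δ := r ^ 2 * (a ⟨k, hk⟩ - a' ⟨k, hk⟩) ^ 2)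
      (by have := A.measurable_prediction_right x s ⟨k, hk⟩; fun_prop) (by fun_prop) fun y => ?_
    · refine ChiSqDom.mono (ChiSqDom.map hstep measurable_snoc) (le_of_eq ?_)
      rw [← ENNReal.ofReal_mul (Real.exp_nonneg _), ← Real.exp_add, Fin.sum_univ_castSucc]
      congr 3
      push_cast
      simp only [Fin.castLE, Fin.last]
      field_simp
    · have h := sq_le_sq' (abs_le.1 (A.abs_prediction_le x hr s ⟨k, hk⟩ y)).1
        (abs_le.1 (A.abs_prediction_le x hr s ⟨k, hk⟩ y)).2
      have := mul_le_mul_of_nonneg_left h (sq_nonneg (a ⟨k, hk⟩ - a' ⟨k, hk⟩))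
      linarith

/-- The expectation over the noise of the predicted value of round `t`, for a fixed seed. -/
noncomputable def meanPrediction (s : S) (t : Fin T) : ℝ :=
  ∫ ω, inner ℝ (A.play (affineEnv x a) ω s t : E d) (x t : E d) ∂noise T

theorem meanPrediction_eq (s : S) (t : Fin T) :
    A.meanPrediction x a s t
      = ∫ y, A.prediction x s t y ∂A.historyLaw x a s t t.isLt.le := by
  have hm := A.measurable_history_left x a s t t.isLt.le
  have hp := A.measurable_prediction_right x s t
  rw [historyLaw, integral_map hm.aemeasurable hp.aestronglyMeasurable, meanPrediction]
  simp_rw [inner_play]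

theorem abs_meanPrediction_sub_le {r : ℝ}
    (hr : ∀ t, ∀ w ∈ W, |inner ℝ w (x t : E d)| ≤ r)
    (haa' : 16 * r ^ 2 * ∑ t, (a t - a' t) ^ 2 ≤ 1 / 8) (s : S) (t : Fin T) :
    |A.meanPrediction x a s t - A.meanPrediction x a' s t| ≤ r / 2 := by
  have hr0 : 0 ≤ r := (abs_nonneg _).trans (A.abs_prediction_le x hr s t 0)
  have hexp : Real.exp (1 / 8) ≤ 5 / 4 := by
    have := Real.exp_bound_div_one_sub_of_interval (x := 1 / 8) (by norm_num) (by norm_num)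
    linarith
  have hsum : ∑ j : Fin t, 16 * r ^ 2 * (a (j.castLE t.isLt.le) - a' (j.castLE t.isLt.le)) ^ 2
      ≤ 1 / 8 := by
    refine le_trans ?_ haa'
    rw [Finset.mul_sum]
    calc _ = ∑ j ∈ Finset.univ.map (Fin.castLEEmb t.isLt.le),
          16 * r ^ 2 * (a j - a' j) ^ 2 := by rw [Finset.sum_map]; rfl
      _ ≤ _ := Finset.sum_le_sum_of_subset_of_nonneg (Finset.subset_univ _)
          fun _ _ _ => by positivity
  have h := ((A.historyLaw_chiSqDom x a a' hr s t t.isLt.le).mono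
    (ENNReal.ofReal_le_ofReal ((Real.exp_le_exp.2 hsum).trans hexp))).sq_integral_sub_le
    (by norm_num) (A.measurable_prediction_right x s t) (A.abs_prediction_le x hr s t)
  rw [← meanPrediction_eq, ← meanPrediction_eq] at h
  exact abs_le_of_sq_le_sq (by linarith) (by positivity)

end Algorithm

/-! ### Averaging over the signs -/

/-- A sign `±1` encoded by a Boolean. -/
def boolSign (b : Bool) : ℝ := if b then 1 else -1

theorem boolSign_not (b : Bool) : boolSign (!b) = -boolSign b := by cases b <;> simp [boolSign]

theorem abs_boolSign (b : Bool) : |boolSign b| = 1 := by cases b <;> simp [boolSign]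

theorem boolSign_mul_self (b : Bool) : boolSign b * boolSign b = 1 := by cases b <;> simp [boolSign]

section Averaging

variable {ι : Type*} [DecidableEq ι] [Fintype ι]

/-- If `H` does not depend on the sign `i`, then flipping this sign cancels the sum in pairs. -/
theorem sum_boolSign_mul_eq_zero (i : ι) (H : (ι → Bool) → ℝ)
    (hH : ∀ σ b, H (Function.update σ i b) = H σ) : ∑ σ : ι → Bool, boolSign (σ i) * H σ = 0 := by
  refine Finset.sum_involution (fun σ _ => Function.update σ i (!σ i)) (fun σ _ => ?_)
    (fun σ _ _ h => ?_) (fun _ _ => Finset.mem_univ _) (fun σ _ => ?_)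
  · rw [hH, Function.update_self, boolSign_not]
    ring
  · have := congrFun h i
    simp at this
  · simp

variable (A : Algorithm d T W (Metric.closedBall (0 : E d) 1) S)
  (x : Fin T → Metric.closedBall (0 : E d) 1)

/-- On average over the signs, no learner gains more than half of what the corner opposite to the
signs gains. The slope of round `t` is `μ` times the sign of its block, and `hblock` limits the
information about each sign. -/
theorem sum_signs_meanPrediction_ge (block : Fin T → ι) {r μ : ℝ} (hμ : 0 ≤ μ)
    (hr : ∀ t, ∀ w ∈ W, |inner ℝ w (x t : E d)| ≤ r)
    (hblock : ∀ i, 16 * r ^ 2 * (μ ^ 2 * (Finset.univ.filter fun t => block t = i).card) ≤ 1 / 8)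
    (s : S) :
    ∑ _σ : ι → Bool, -(T * (μ * (r / 2))) ≤ ∑ σ : ι → Bool, ∑ t,
      μ * boolSign (σ (block t)) *
        A.meanPrediction x (fun t => μ * boolSign (σ (block t))) s t := by
  have key : ∀ t : Fin T, ∑ _σ : ι → Bool, -(μ * (r / 2)) ≤ ∑ σ : ι → Bool,
      μ * boolSign (σ (block t)) *
        A.meanPrediction x (fun t => μ * boolSign (σ (block t))) s t := by
    intro t
    -- the slopes of the block of round `t` are replaced by `0`, so that the prediction is
    -- independent of the sign of this block
    let a' : (ι → Bool) → Fin T → ℝ :=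
      fun σ t' => if block t' = block t then 0 else μ * boolSign (σ (block t'))
    have hz := sum_boolSign_mul_eq_zero (block t) (fun σ => A.meanPrediction x (a' σ) s t) (by
      intro σ b
      congr 1
      funext t'
      simp only [a']
      split_ifs with h
      · rfl
      · rw [Function.update_of_ne h])
    have hle : ∀ σ : ι → Bool, -(μ * (r / 2))
        + μ * (boolSign (σ (block t)) * A.meanPrediction x (a' σ) s t)
        ≤ μ * boolSign (σ (block t)) *
          A.meanPrediction x (fun t => μ * boolSign (σ (block t))) s t := by
      intro σ
      have hd := A.abs_meanPrediction_sub_le x (fun t => μ * boolSign (σ (block t))) (a' σ) hr (by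
        refine le_trans (le_of_eq ?_) (hblock (block t))
        congr 1
        rw [Finset.card_filter, Nat.cast_sum, Finset.mul_sum]
        refine Finset.sum_congr rfl fun t' _ => ?_
        simp only [a']
        split_ifs with h
        · rw [sub_zero, mul_pow, pow_two (boolSign _), boolSign_mul_self]
          simp
        · simp) s t
      have h2 : |boolSign (σ (block t)) *
          (A.meanPrediction x (fun t => μ * boolSign (σ (block t))) s t
          - A.meanPrediction x (a' σ) s t)| ≤ r / 2 := by
        rwa [abs_mul, abs_boolSign, one_mul]
      have h3 := mul_le_mul_of_nonneg_left (abs_le.1 h2).1 hμ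
      linarith
    calc ∑ _σ : ι → Bool, -(μ * (r / 2))
        = ∑ σ : ι → Bool, (-(μ * (r / 2))
          + μ * (boolSign (σ (block t)) * A.meanPrediction x (a' σ) s t)) := by
          rw [Finset.sum_add_distrib, ← Finset.mul_sum, hz, mul_zero, add_zero]
      _ ≤ _ := Finset.sum_le_sum fun σ _ => hle σ
  rw [Finset.sum_comm]
  calc ∑ _σ : ι → Bool, -(T * (μ * (r / 2)))
      = ∑ _t : Fin T, ∑ _σ : ι → Bool, -(μ * (r / 2)) := by
        rw [Finset.sum_comm]
        refine Finset.sum_congr rfl fun _ _ => ?_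
        simp
    _ ≤ _ := Finset.sum_le_sum fun t _ => key t

theorem integrable_inner_play (ν : Measure S) [IsProbabilityMeasure ν] (a : Fin T → ℝ) {r : ℝ}
    (hr : ∀ t, ∀ w ∈ W, |inner ℝ w (x t : E d)| ≤ r) (t : Fin T) :
    Integrable (fun p : (Fin T → ℝ) × S =>
      inner ℝ (A.play (affineEnv x a) p.1 p.2 t : E d) (x t : E d)) ((noise T).prod ν) :=
  Integrable.of_bound (A.measurable_inner_play x a t).aestronglyMeasurable r
    (.of_forall fun _ => hr t _ (Subtype.coe_prop _))

/-- The average over the signs commutes with the expectation over the seed, so some choice of the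
signs is as bad for the learner as the average. -/
theorem exists_signs_integral_ge (ν : Measure S) [IsProbabilityMeasure ν] (block : Fin T → ι)
    {r μ : ℝ} (hμ : 0 ≤ μ) (hr : ∀ t, ∀ w ∈ W, |inner ℝ w (x t : E d)| ≤ r)
    (hblock : ∀ i, 16 * r ^ 2 * (μ ^ 2 * (Finset.univ.filter fun t => block t = i).card) ≤ 1 / 8) :
    ∃ σ : ι → Bool, -(T * (μ * (r / 2))) ≤ ∫ p, ∑ t, μ * boolSign (σ (block t)) *
      inner ℝ (A.play (affineEnv x fun t => μ * boolSign (σ (block t))) p.1 p.2 t : E d) (x t : E d)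
      ∂(noise T).prod ν := by
  have hint := integrable_inner_play A x ν (hr := hr)
  suffices h : ∑ _σ : ι → Bool, -(T * (μ * (r / 2))) ≤ ∑ σ : ι → Bool,
      ∫ p, ∑ t, μ * boolSign (σ (block t)) *
      inner ℝ (A.play (affineEnv x fun t => μ * boolSign (σ (block t))) p.1 p.2 t : E d) (x t : E d)
      ∂(noise T).prod ν by
    obtain ⟨σ, -, h⟩ := Finset.exists_le_of_sum_le Finset.univ_nonempty h
    exact ⟨σ, h⟩
  have hmean : ∀ a t, Integrable (fun s => A.meanPrediction x a s t) ν :=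
    fun a t => (hint a t).integral_prod_right
  have heq : ∀ σ : ι → Bool, (∫ p, ∑ t, μ * boolSign (σ (block t)) *
      inner ℝ (A.play (affineEnv x fun t => μ * boolSign (σ (block t))) p.1 p.2 t : E d) (x t : E d)
      ∂(noise T).prod ν) = ∫ s, ∑ t, μ * boolSign (σ (block t)) *
        A.meanPrediction x (fun t => μ * boolSign (σ (block t))) s t ∂ν := by
    intro σ
    rw [integral_finsetSum _ fun t _ => (hint _ t).const_mul _,
      integral_finsetSum _ fun t _ => (hmean _ t).const_mul _]
    refine Finset.sum_congr rfl fun t _ => ?_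
    rw [integral_const_mul, integral_const_mul, integral_prod_symm _ (hint _ t)]
    rfl
  have hmean' : ∀ σ : ι → Bool, Integrable (fun s => ∑ t, μ * boolSign (σ (block t)) *
      A.meanPrediction x (fun t => μ * boolSign (σ (block t))) s t) ν :=
    fun σ => integrable_finsetSum _ fun t _ => (hmean _ t).const_mul _
  rw [Finset.sum_congr rfl fun σ _ => heq σ, ← integral_finsetSum _ fun σ _ => hmean' σ]
  calc ∑ _σ : ι → Bool, -(T * (μ * (r / 2)))
      = ∫ _s, ∑ _σ : ι → Bool, -(T * (μ * (r / 2))) ∂ν := by simp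
    _ ≤ _ := integral_mono (integrable_const _) (integrable_finsetSum _ fun σ _ => hmean' σ)
        fun s => sum_signs_meanPrediction_ge A x block hμ hr hblock s

end Averaging

/-! ### The affine environment fulfils the requirements -/

theorem sum_affineEnv_loss (x : Fin T → Metric.closedBall (0 : E d) 1) (a ω : Fin T → ℝ)
    (w : Fin T → E d) :
    ∑ t, (affineEnv x a).loss t ω (w t)
      = ∑ t, a t * inner ℝ (w t) (x t : E d) + ∑ t, (1 / 2 + ω t) := by
  rw [← Finset.sum_add_distrib]
  exact Finset.sum_congr rfl fun t _ => by rw [affineEnv_loss]; ring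

/-- The noise is the same for all points of `W`, so it does not influence the minimizers. -/
theorem isMinOn_affineEnv {x : Fin T → Metric.closedBall (0 : E d) 1} {a : Fin T → ℝ} {w₀ : E d}
    (hmin : ∀ w ∈ W, ∑ t, a t * inner ℝ w₀ (x t : E d) ≤ ∑ t, a t * inner ℝ w (x t : E d))
    (ω : Fin T → ℝ) : IsMinOn (fun v => ∑ t, (affineEnv x a).loss t ω v) W w₀ := by
  refine isMinOn_iff.2 fun w hw => ?_
  have h1 := sum_affineEnv_loss x a ω fun _ => w₀
  have h2 := sum_affineEnv_loss x a ω fun _ => w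
  have := hmin w hw
  linarith

theorem regret_affineEnv (A : Algorithm d T W (Metric.closedBall (0 : E d) 1) S)
    {x : Fin T → Metric.closedBall (0 : E d) 1} {a : Fin T → ℝ} {w₀ : E d} (hw₀ : w₀ ∈ W)
    (hmin : ∀ w ∈ W, ∑ t, a t * inner ℝ w₀ (x t : E d) ≤ ∑ t, a t * inner ℝ w (x t : E d))
    (ω : Fin T → ℝ) (s : S) :
    A.regret (affineEnv x a) ω s
      = ∑ t, a t * inner ℝ (A.play (affineEnv x a) ω s t : E d) (x t : E d)
        - ∑ t, a t * inner ℝ w₀ (x t : E d) := by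
  have hinf : ⨅ w : W, ∑ t, (affineEnv x a).loss t ω w = ∑ t, (affineEnv x a).loss t ω w₀ := by
    have hle : IsLeast (Set.range fun w : W => ∑ t, (affineEnv x a).loss t ω w)
        (∑ t, (affineEnv x a).loss t ω w₀) :=
      ⟨⟨⟨w₀, hw₀⟩, rfl⟩, by
        rintro _ ⟨w, rfl⟩
        exact isMinOn_iff.1 (isMinOn_affineEnv hmin ω) w w.2⟩
    exact hle.csInf_eq
  rw [Algorithm.regret, hinf,
    sum_affineEnv_loss x a ω fun t => (A.play (affineEnv x a) ω s t : E d),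
    sum_affineEnv_loss x a ω fun _ => w₀]
  ring

/-- An affine environment with slopes at most `1` meets all requirements on the adversary; what
remains is the bound on the regret against a minimizer `w₀`, in which the noise cancels. -/
theorem exists_environment_of_le (hW : W ⊆ Metric.closedBall 0 1) (ν : Measure S)
    [IsProbabilityMeasure ν] (A : Algorithm d T W (Metric.closedBall (0 : E d) 1) S)
    (x : Fin T → Metric.closedBall (0 : E d) 1) (a : Fin T → ℝ) (ha : ∀ t, |a t| ≤ 1)
    (hval : ∀ t, ∀ w ∈ W, |a t * inner ℝ w (x t : E d)| ≤ 1 / 2) {w₀ : E d} (hw₀ : w₀ ∈ W)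
    (hmin : ∀ w ∈ W, ∑ t, a t * inner ℝ w₀ (x t : E d) ≤ ∑ t, a t * inner ℝ w (x t : E d))
    {B : ℝ} (hB : B ≤ ∫ p, ∑ t, a t * inner ℝ (A.play (affineEnv x a) p.1 p.2 t : E d) (x t : E d)
      ∂(noise T).prod ν - ∑ t, a t * inner ℝ w₀ (x t : E d)) :
    ∃ (Ω : Type) (_ : MeasurableSpace Ω) (P : Measure Ω) (_ : IsProbabilityMeasure P)
        (env : Environment d T (Metric.closedBall (0 : E d) 1) Ω),
        (∀ t w x, env.g t w x = inner ℝ w (x : E d)) ∧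
        (∃ (m : Fin T → ℝ → ℝ) (ε : Fin T → Ω → ℝ),
          iIndepFun ε P ∧ (∀ t, HasLaw (ε t) (gaussianReal 0 (1 / 16 : ℝ≥0)) P) ∧
          ∀ t ω z, env.ℓ t ω z = m t z + ε t ω) ∧
        (∀ t, ∀ w ∈ W, Integrable (fun ω => env.loss t ω w) P ∧
          ∫ ω, env.loss t ω w ∂P ∈ Set.Icc (0 : ℝ) 1) ∧
        (∀ t ω, ConvexityAssumption W (env.ℓ t ω) (fun w => env.g t w (env.x t))) ∧
        (∀ t ω, LipschitzAssumption 1 W (env.ℓ t ω) (fun w => env.g t w (env.x t))) ∧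
        (∀ t, BoundednessAssumption (-1) 1 1 W (env.g t)) ∧
        (∀ ω, ∃ w ∈ W, IsMinOn (fun v => ∑ t, env.loss t ω v) W w) ∧
        Integrable (fun p : Ω × S => A.regret env p.1 p.2) (P.prod ν) ∧
        B ≤ ∫ p, A.regret env p.1 p.2 ∂(P.prod ν) := by
  have hmp : ∀ t, MeasurePreserving (fun ω : Fin T → ℝ => ω t) (noise T)
      (gaussianReal 0 (1 / 16 : ℝ≥0)) := fun t =>
    measurePreserving_eval (fun _ : Fin T => gaussianReal 0 (1 / 16 : ℝ≥0)) t
  have hplay : Integrable (fun p : (Fin T → ℝ) × S =>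
      ∑ t, a t * inner ℝ (A.play (affineEnv x a) p.1 p.2 t : E d) (x t : E d))
      ((noise T).prod ν) := by
    refine integrable_finsetSum _ fun t _ =>
      (integrable_inner_play A x ν a (r := 1) (fun t w hw => ?_) t).const_mul _
    refine (abs_real_inner_le_norm _ _).trans (mul_le_one₀ ?_ (norm_nonneg _) ?_)
    · simpa using hW hw
    · exact mem_closedBall_zero_iff.1 (x t).2
  refine ⟨Fin T → ℝ, inferInstance, noise T, inferInstance, affineEnv x a, fun _ _ _ => rfl,
    ⟨fun t z => 1 / 2 + a t * z, fun t ω => ω t, ?_, fun t => ?_, fun _ _ _ => rfl⟩,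
    fun t w hw => ?_, fun t ω w₁ _ w₂ _ c _ => ?_, fun t ω w₁ _ w₂ _ => ?_, fun t u w hw => ?_,
    fun ω => ⟨w₀, hw₀, isMinOn_affineEnv hmin ω⟩, ?_, ?_⟩
  · exact iIndepFun_pi (X := fun _ y => y) fun _ => aemeasurable_id
  · exact ⟨(hmp t).measurable.aemeasurable, (hmp t).map_eq⟩
  · have hi : Integrable (fun ω : Fin T → ℝ => ω t) (noise T) :=
      (hmp t).integrable_comp_of_integrable
        (memLp_one_iff_integrable.1 (memLp_id_gaussianReal 1))
    have h0 : ∫ ω : Fin T → ℝ, ω t ∂noise T = 0 := by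
      rw [← integral_map (f := fun y => y) (hmp t).measurable.aemeasurable
        aestronglyMeasurable_id, (hmp t).map_eq, integral_id_gaussianReal]
    simp_rw [affineEnv_loss]
    refine ⟨(integrable_const _).add hi, ?_⟩
    rw [integral_add (integrable_const _) hi, h0]
    have := abs_le.1 (hval t w hw)
    simp only [integral_const, probReal_univ, smul_eq_mul, one_mul]
    constructor <;> linarith
  · simp only [affineEnv, inner_add_left, real_inner_smul_left]
    constructor <;> apply le_of_eq <;> ring
  · simp only [affineEnv, one_mul]
    rw [show ∀ u v : ℝ, 1 / 2 + a t * u + ω t - (1 / 2 + a t * v + ω t) = a t * (u - v) by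
      intros; ring, abs_mul]
    exact mul_le_of_le_one_left (abs_nonneg _) (ha t)
  · have hu : ‖(u : E d)‖ ≤ 1 := mem_closedBall_zero_iff.1 u.2
    have hw1 : ‖w‖ ≤ 1 := by simpa using hW hw
    have hg : HasGradientAt (fun v : E d => inner ℝ v (u : E d)) (u : E d) w := by
      rw [hasGradientAt_iff_hasFDerivAt]
      have := (InnerProductSpace.toDual ℝ (E d) (u : E d)).hasFDerivAt (x := w)
      exact this.congr_of_eventuallyEq (.of_forall fun v => by simp [real_inner_comm])
    refine ⟨abs_le.1 ((abs_real_inner_le_norm _ _).trans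
      (mul_le_one₀ hw1 (norm_nonneg _) hu)), hg.differentiableAt, ?_⟩
    change ‖gradient (fun v : E d => inner ℝ v (u : E d)) w‖ ≤ 1
    rwa [hg.gradient]
  · simp_rw [regret_affineEnv A hw₀ hmin]
    exact hplay.sub (integrable_const _)
  · simp_rw [regret_affineEnv A hw₀ hmin]
    rw [integral_sub hplay (integrable_const _)]
    simpa using hB

theorem card_filter_mod_eq_le (T n : ℕ) (i : ℕ) :
    (Finset.univ.filter fun t : Fin T => t.val % n = i).card ≤ T / n + 1 := by
  refine (Finset.card_le_card_of_injOn (t := Finset.range (T / n + 1)) (fun t => t.val / n)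
    (fun t _ => ?_) fun t ht t' ht' h => ?_).trans (Finset.card_range _).le
  · simp only [Finset.coe_range, Set.mem_Iio]
    exact Nat.lt_succ_of_le (Nat.div_le_div_right t.isLt.le)
  · simp only [Finset.coe_filter, Finset.mem_univ, true_and, Set.mem_ofPred_eq] at ht ht' h
    ext
    rw [← Nat.div_add_mod t.val n, ← Nat.div_add_mod t'.val n, h, ht, ht']

/-! ### The action set -/

/-- The cube of half-side `r` in the first `n` coordinates of `ℝ^d`; the other coordinates vanish.
-/
def box (d n : ℕ) (r : ℝ) : Set (E d) :=
  {w | ∀ i, |w i| ≤ if i.val < n then r else 0}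

theorem zero_mem_box {n : ℕ} {r : ℝ} (hr : 0 ≤ r) : (0 : E d) ∈ box d n r := by
  intro i
  simp only [PiLp.zero_apply, abs_zero]
  split_ifs
  · exact hr
  · exact le_rfl

theorem isClosed_box (n : ℕ) (r : ℝ) : IsClosed (box d n r) := by
  simp only [box, Set.ofPred_forall]
  exact isClosed_iInter fun i => isClosed_le (by fun_prop) continuous_const

theorem convex_box (n : ℕ) (r : ℝ) : Convex ℝ (box d n r) := by
  intro w₁ h₁ w₂ h₂ a b ha hb hab i
  set M : ℝ := if i.val < n then r else 0
  calc |(a • w₁ + b • w₂) i| = |a * w₁ i + b * w₂ i| := by simp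
    _ ≤ |a * w₁ i| + |b * w₂ i| := abs_add_le _ _
    _ = a * |w₁ i| + b * |w₂ i| := by rw [abs_mul, abs_mul, abs_of_nonneg ha, abs_of_nonneg hb]
    _ ≤ a * M + b * M := by
        gcongr
        · exact h₁ i
        · exact h₂ i
    _ = M := by rw [← add_mul, hab, one_mul]

theorem box_subset_closedBall {n : ℕ} (hn : n ≤ d) {r : ℝ} (hr : n * r ^ 2 ≤ 1) :
    box d n r ⊆ Metric.closedBall 0 1 := by
  intro w hw
  rw [mem_closedBall_zero_iff]
  refine abs_le_of_sq_le_sq' ?_ zero_le_one |>.2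
  rw [EuclideanSpace.norm_sq_eq, one_pow]
  calc ∑ i, ‖w i‖ ^ 2 ≤ ∑ i : Fin d, if i.val < n then r ^ 2 else 0 := by
        refine Finset.sum_le_sum fun i _ => ?_
        have h := pow_le_pow_left₀ (abs_nonneg _) (hw i) 2
        rw [Real.norm_eq_abs]
        split_ifs at h ⊢
        · exact h
        · simpa using h
    _ = n * r ^ 2 := by
        rw [← Finset.sum_filter, Finset.sum_const, nsmul_eq_mul]
        congr 2
        have : (Finset.univ.filter fun i : Fin d => i.val < n)
            = Finset.univ.map (Fin.castLEEmb hn) := by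
          ext i
          simp only [Finset.mem_filter, Finset.mem_univ, true_and, Finset.mem_map]
          exact ⟨fun h => ⟨⟨i, h⟩, rfl⟩, by rintro ⟨j, rfl⟩; exact j.isLt⟩
        rw [this, Finset.card_map, Finset.card_univ, Fintype.card_fin]
    _ ≤ 1 := hr

/-- The corner `-r σ` of the cube, the best point against slopes with the signs `σ`. -/
noncomputable def boxCorner {n : ℕ} (d : ℕ) (r : ℝ) (σ : Fin n → Bool) : E d :=
  WithLp.toLp 2 fun i => if h : i.val < n then -(r * boolSign (σ ⟨i, h⟩)) else 0

theorem boxCorner_mem {n : ℕ} {r : ℝ} (hr : 0 ≤ r) (σ : Fin n → Bool) :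
    boxCorner d r σ ∈ box d n r := by
  intro i
  by_cases h : i.val < n <;> simp [boxCorner, h, abs_mul, abs_boolSign, abs_of_nonneg hr]

theorem min_sqrt_le_sqrt_min {T : ℕ} :
    min (Real.sqrt (d * T)) ((T : ℝ) ^ (3 / 4 : ℝ))
      ≤ Real.sqrt ((min d ⌈Real.sqrt T⌉₊ : ℕ) * T) := by
  rcases le_total d ⌈Real.sqrt T⌉₊ with h | h
  · rw [min_eq_left h]
    exact min_le_left _ _
  · rw [min_eq_right h]
    refine (min_le_right _ _).trans ?_
    have hT : (0 : ℝ) ≤ T := Nat.cast_nonneg T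
    have : (T : ℝ) ^ (3 / 4 : ℝ) = Real.sqrt (Real.sqrt T * T) := by
      nth_rewrite 3 [← Real.rpow_one (T : ℝ)]
      rw [Real.sqrt_eq_rpow, Real.sqrt_eq_rpow, ← Real.rpow_add_of_nonneg hT (by norm_num)
        (by norm_num), ← Real.rpow_mul hT]
      norm_num
    rw [this]
    gcongr
    exact Nat.le_ceil _

end PBCO

/-! ### The lower bound -/

theorem theorem1 (d T : ℕ) :
    ∃ W : Set (PBCO.E d),
      W.Nonempty ∧ IsClosed W ∧ Convex ℝ W ∧ W ⊆ Metric.closedBall 0 1 ∧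
      ∀ (S : Type*) [MeasurableSpace S] (ν : Measure S) [IsProbabilityMeasure ν]
        (A : PBCO.Algorithm d T W (Metric.closedBall (0 : PBCO.E d) 1) S),
      ∃ (Ω : Type) (_ : MeasurableSpace Ω) (P : Measure Ω) (_ : IsProbabilityMeasure P)
        (env : PBCO.Environment d T (Metric.closedBall (0 : PBCO.E d) 1) Ω),
        -- linear predictions
        (∀ t w x, env.g t w x = inner ℝ w (x : PBCO.E d)) ∧
        -- the losses are fixed functions plus independent Gaussian noise of variance 1/16
        (∃ (m : Fin T → ℝ → ℝ) (ε : Fin T → Ω → ℝ),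
          iIndepFun ε P ∧ (∀ t, HasLaw (ε t) (gaussianReal 0 (1 / 16 : ℝ≥0)) P) ∧
          ∀ t ω z, env.ℓ t ω z = m t z + ε t ω) ∧
        -- expected losses in [0, 1]
        (∀ t, ∀ w ∈ W, Integrable (fun ω => env.loss t ω w) P ∧
          ∫ ω, env.loss t ω w ∂P ∈ Set.Icc (0 : ℝ) 1) ∧
        -- convexity, Lipschitz continuity and boundedness assumptions
        (∀ t ω, PBCO.ConvexityAssumption W (env.ℓ t ω) (fun w => env.g t w (env.x t))) ∧
        (∀ t ω, PBCO.LipschitzAssumption 1 W (env.ℓ t ω) (fun w => env.g t w (env.x t))) ∧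
        (∀ t, PBCO.BoundednessAssumption (-1) 1 1 W (env.g t)) ∧
        -- the minimum over the comparators is attained
        (∀ ω, ∃ w ∈ W, IsMinOn (fun v => ∑ t, env.loss t ω v) W w) ∧
        -- expected regret
        Integrable (fun p : Ω × S => A.regret env p.1 p.2) (P.prod ν) ∧
        1 / 32 * min (Real.sqrt ((d : ℝ) * T)) ((T : ℝ) ^ (3 / 4 : ℝ)) ≤
          ∫ p, A.regret env p.1 p.2 ∂(P.prod ν) := by
  open PBCO in
  rcases Nat.eq_zero_or_pos (d * T) with hdT | hdT
  -- for `d = 0` or `T = 0` the bound is `0`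
  · refine ⟨{0}, Set.singleton_nonempty _, isClosed_singleton, convex_singleton _, by simp,
      fun S _ ν _ A => ?_⟩
    refine exists_environment_of_le (by simp) ν A (fun _ => ⟨0, by simp⟩) (fun _ => 0) (by simp)
      (by simp) (w₀ := 0) rfl (by simp) ?_
    have h0 : Real.sqrt ((d : ℝ) * T) = 0 := by
      rw [← Nat.cast_mul, hdT, Nat.cast_zero, Real.sqrt_zero]
    have hle := min_le_left (Real.sqrt ((d : ℝ) * T)) ((T : ℝ) ^ (3 / 4 : ℝ))
    simp only [zero_mul, Finset.sum_const_zero, integral_zero, sub_zero]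
    linarith
  have hd : 0 < d := Nat.pos_of_mul_pos_right hdT
  have hT : 0 < T := Nat.pos_of_mul_pos_left hdT
  set n := min d ⌈Real.sqrt T⌉₊
  have hT1 : (1 : ℝ) ≤ T := by exact_mod_cast hT
  have hsT : 1 ≤ Real.sqrt T := Real.one_le_sqrt.2 hT1
  have hsq : Real.sqrt T ^ 2 = T := Real.sq_sqrt (by linarith)
  have hn : 0 < n := lt_min hd (Nat.ceil_pos.2 (by linarith))
  have hnd : n ≤ d := min_le_left _ _
  have hnT : n ≤ T := (min_le_right _ _).trans (Nat.ceil_le.2 (by nlinarith))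
  have hn0 : (0 : ℝ) < n := by exact_mod_cast hn
  have hn1 : (1 : ℝ) ≤ n := by exact_mod_cast hn
  have hn2 : (n : ℝ) ≤ 2 * Real.sqrt T := by
    have h1 : (n : ℝ) ≤ ⌈Real.sqrt T⌉₊ := by exact_mod_cast min_le_right _ _
    have h2 := Nat.ceil_lt_add_one (Real.sqrt_nonneg T)
    linarith
  have hsn : 1 ≤ Real.sqrt n := Real.one_le_sqrt.2 hn1
  have hsqn : Real.sqrt n ^ 2 = n := Real.sq_sqrt hn0.le
  obtain ⟨r, hr⟩ : ∃ r, r = 1 / Real.sqrt n := ⟨_, rfl⟩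
  have hr0 : 0 < r := by rw [hr]; positivity
  have hr1 : r ≤ 1 := by rw [hr]; exact (div_le_one (by linarith)).2 hsn
  have hnr : n * r ^ 2 = 1 := by
    rw [hr, div_pow, hsqn, one_pow]
    field_simp
  obtain ⟨μ, hμ⟩ : ∃ μ, μ = n / (16 * Real.sqrt T) := ⟨_, rfl⟩
  have hμ0 : 0 < μ := by rw [hμ]; positivity
  have hμ1 : μ ≤ 1 / 2 := by
    rw [hμ, div_le_iff₀ (by positivity)]
    linarith
  have hW := box_subset_closedBall hnd hnr.le
  refine ⟨box d n r, ⟨0, zero_mem_box hr0.le⟩, isClosed_box n r, convex_box n r, hW,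
    fun S _ ν _ A => ?_⟩
  let block : Fin T → Fin n := fun t => ⟨t % n, Nat.mod_lt _ hn⟩
  let x : Fin T → Metric.closedBall (0 : E d) 1 :=
    fun t => ⟨EuclideanSpace.single ((block t).castLE hnd) 1, by simp⟩
  have hx : ∀ t (w : E d), inner ℝ w (x t : E d) = w ((block t).castLE hnd) := by
    intro t w
    simp [x, EuclideanSpace.inner_single_right]
  have hxr : ∀ t, ∀ w ∈ box d n r, |inner ℝ w (x t : E d)| ≤ r := by
    intro t w hw
    rw [hx]
    have := hw ((block t).castLE hnd)
    rwa [if_pos (by exact (block t).isLt)] at this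
  have hblock : ∀ i, 16 * r ^ 2 * (μ ^ 2 * (Finset.univ.filter fun t => block t = i).card)
      ≤ 1 / 8 := by
    intro i
    have hcard : ((Finset.univ.filter fun t => block t = i).card : ℝ) ≤ 2 * T / n := by
      have h1 : (Finset.univ.filter fun t => block t = i).card ≤ T / n + 1 := by
        simpa only [block, Fin.ext_iff] using card_filter_mod_eq_le T n i
      have h2 : ((T / n : ℕ) : ℝ) ≤ T / n := Nat.cast_div_le
      have h3 : (1 : ℝ) ≤ T / n := (one_le_div hn0).2 (by exact_mod_cast hnT)
      have h4 : ((Finset.univ.filter fun t => block t = i).card : ℝ) ≤ (T / n : ℕ) + 1 := by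
        exact_mod_cast h1
      have h5 : (2 : ℝ) * T / n = T / n + T / n := by ring
      linarith
    calc 16 * r ^ 2 * (μ ^ 2 * (Finset.univ.filter fun t => block t = i).card)
        ≤ 16 * r ^ 2 * (μ ^ 2 * (2 * T / n)) := by gcongr
      _ = 1 / 8 := by
        rw [hμ, hr, div_pow, div_pow, mul_pow, hsq, hsqn]
        field_simp
        norm_num
  obtain ⟨σ, hσ⟩ := exists_signs_integral_ge A x ν block hμ0.le hxr hblock
  have hcorner : ∀ t, μ * boolSign (σ (block t)) * inner ℝ (boxCorner d r σ) (x t : E d)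
      = -(μ * r) := by
    intro t
    have h : boxCorner d r σ ((block t).castLE hnd) = -(r * boolSign (σ (block t))) :=
      dif_pos (block t).isLt
    rw [hx, h]
    linear_combination (-(μ * r)) * boolSign_mul_self (σ (block t))
  refine exists_environment_of_le hW ν A x (fun t => μ * boolSign (σ (block t))) (fun t => ?_)
    (fun t w hw => ?_) (boxCorner_mem hr0.le σ) (fun w hw => ?_) ?_
  · rw [abs_mul, abs_boolSign, abs_of_pos hμ0]
    linarith
  · rw [abs_mul, abs_mul, abs_boolSign, abs_of_pos hμ0, mul_one]
    have := hxr t w hw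
    nlinarith [abs_nonneg (inner ℝ w (x t : E d))]
  · refine Finset.sum_le_sum fun t _ => ?_
    rw [hcorner]
    refine (neg_le_neg ?_).trans (neg_abs_le _)
    rw [abs_mul, abs_mul, abs_boolSign, abs_of_pos hμ0, mul_one]
    exact mul_le_mul_of_nonneg_left (hxr t w hw) hμ0.le
  · simp_rw [hcorner]
    have hmin := min_sqrt_le_sqrt_min (d := d) (T := T)
    have hval : (T : ℝ) * (μ * (r / 2)) = 1 / 32 * Real.sqrt (n * T) := by
      rw [Real.sqrt_mul hn0.le, hμ, hr]
      field_simp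
      rw [hsq, hsqn]
      ring
    simp only [Finset.sum_const, Finset.card_univ, Fintype.card_fin, nsmul_eq_mul]
    linarith
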